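/- Let $S\subset\mathbb R^2$ be the $x$-axis (the flat substrate). A *closed curve* is a set $\Gamma=\gamma([0,1])\subset\mathbb R^2$ with $\gamma:[0,1]\to\mathbb R^2$ continuous, $\gamma(0)=\gamma(1)$ and $\gamma$ injective on $[0,1)$. An *open curve on the flat substrate* is a set $\Gamma=\gamma([0,1])$ with $\gamma=(x,y):[0,1]\to\mathbb R^2$ continuous and injective, $y(0)=y(1)=0$, $x(0)<x(1)$, and $y(t)\neq 0$ for $0<t<1$. The inner region $\Omega$ of $\Gamma$ is the union of the bounded connected components of $\mathbb R^2\setminus\Gamma$ if $\Gamma$ is closed, and of $\mathbb R^2\setminus(\Gamma\cup S)$ if $\Gamma$ is an open curve on the substrate. Let $\Gamma_1,\Gamma_2,\Gamma_3$ be three closed curves, or three open curves on the flat substrate, with inner regions $\Omega_1,\Omega_2,\Omega_3$, and let $$M(\Gamma_i,\Gamma_j):=|(\Omega_i\setminus\Omega_j)\cup(\Omega_j\setminus\Omega_i)|,$$ where $|\cdot|$ denotes area. Then the regions $\Omega_i$ are measurable with finite area, $M(\Gamma_1,\Gamma_2)=|\Omega_1|+|\Omega_2|-2|\Omega_1\cap\Omega_2|$,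 and (i) (Symmetry) $M(\Gamma_1,\Gamma_2)=M(\Gamma_2,\Gamma_1)$; (ii) (Positivity) $M(\Gamma_1,\Gamma_2)\ge 0$, and $M(\Gamma_1,\Gamma_2)=0$ if and only if $\Gamma_1=\Gamma_2$ (as subsets of the plane); (iii) (Triangle inequality) $M(\Gamma_1,\Gamma_2)\le M(\Gamma_1,\Gamma_3)+M(\Gamma_2,\Gamma_3)$. -/

import Mathlib

open MeasureTheory

/-- The Euclidean plane; its `volume` is Lebesgue measure, that is, area. -/
abbrev Plane : Type := EuclideanSpace ℝ (Fin 2)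

/-- The flat substrate: the horizontal axis `y = 0`. -/
def substrate : Set Plane := {p | p 1 = 0}

/-- A closed curve: the trace of a continuous closed path which is simple (it does not meet itself
except that its end is its beginning). -/
def IsClosedCurve (Γ : Set Plane) : Prop :=
  ∃ γ : ℝ → Plane, ContinuousOn γ (Set.Icc 0 1) ∧ Set.InjOn γ (Set.Ico 0 1) ∧ γ 0 = γ 1 ∧
    γ '' Set.Icc 0 1 = Γ

/-- An open curve on the flat substrate: the trace of a simple continuous path which meets the
substrate exactly at its two end points, the left and the right contact point. -/
def IsOpenCurveOnSubstrate (Γ : Set Plane) : Prop :=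
  ∃ γ : ℝ → Plane, ContinuousOn γ (Set.Icc 0 1) ∧ Set.InjOn γ (Set.Icc 0 1) ∧
    γ 0 ∈ substrate ∧ γ 1 ∈ substrate ∧ γ 0 0 < γ 1 0 ∧
    (∀ t ∈ Set.Ioo (0 : ℝ) 1, γ t ∉ substrate) ∧
    γ '' Set.Icc 0 1 = Γ

/-- The region enclosed by a set `K`: the union of the bounded connected components of the
complement of `K`. -/
def enclosedRegion (K : Set Plane) : Set Plane :=
  {p | p ∈ Kᶜ ∧ Bornology.IsBounded (connectedComponentIn Kᶜ p)}

/-- The two settings in which curves are compared. -/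
inductive CurveSetting : Type
  /-- closed curves in the plane -/
  | closed : CurveSetting
  /-- open curves on the flat substrate -/
  | onSubstrate : CurveSetting

/-- The curves of a setting, as point sets. -/
def CurveSetting.IsCurve : CurveSetting → Set Plane → Prop
  | .closed, Γ => IsClosedCurve Γ
  | .onSubstrate, Γ => IsOpenCurveOnSubstrate Γ

/-- The inner region of a curve: the region enclosed by a closed curve, or the region enclosed by an
open curve together with the substrate. -/
def CurveSetting.innerRegion : CurveSetting → Set Plane → Set Plane
  | .closed, Γ => enclosedRegion Γ
  | .onSubstrate, Γ => enclosedRegion (Γ ∪ substrate)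

/-- The manifold distance: the area of the symmetric difference of the two inner regions. -/
noncomputable def manifoldDistance (S : CurveSetting) (Γ₁ Γ₂ : Set Plane) : ℝ :=
  volume.real ((S.innerRegion Γ₁ \ S.innerRegion Γ₂) ∪ (S.innerRegion Γ₂ \ S.innerRegion Γ₁))

/-!
All claims but one are general facts on the measure of a symmetric difference, once the inner
regions are known to be open and bounded. The exception is that `manifoldDistance` separates curves,
and this rests on the Jordan curve theorem, in the form: a closed curve `Γ` is the frontier of the
closure of the region `Ω` it encloses (`IsClosedCurve.frontier_closure_enclosedRegion`). Indeed, if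
`Ω₁` and `Ω₂` differ by a null set, then the open null set `Ω₁ \ closure Ω₂` is empty, and likewise
with the roles exchanged; so `Ω₁` and `Ω₂` have the same closure, and this closure determines the
curve.

The topology of the plane enters through continuous logarithms: `z - c` has no continuous logarithm
on a circle around `c`, while homotopies of nonvanishing functions lift through `exp`.

* An arc `A` does not separate the plane (`Complex.isPreconnected_compl_range_arc`). If `a` lay in a
  bounded component `U` of `Aᶜ`, extend a logarithm of `z - a` from `A` to the plane by Tietze's
  theorem. The exponential of the extension on `U`, together with `z - a` off `U`, is a
  nonvanishing continuous function on the plane; so it has a logarithm, and then so does `z - a` on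
  a large circle.
* A closed curve separates the plane (`Complex.not_isPreconnected_compl_union_arcs`). Split it into
  arcs `A`, `B` from `p` to `q`. Moving the zero from `p` to `q` along `A` shows that
  `(z - p) / (z - q)` has a logarithm on `Aᶜ`, and similarly on `Bᶜ`. If `Aᶜ ∩ Bᶜ` were connected,
  the two logarithms would differ there by a constant and would glue to a logarithm on the
  complement of `{p, q}`, which cannot exist near `p`.
* Consequently there are a bounded and an unbounded part `Ω`, `V` of the complement of `Γ`, both
  open and nonempty. Each point `p` of `Γ` is in the closure of both: removing from `Γ` a small piece
  near `p` leaves an arc, whose complement is connected and is covered by `Ω`, `V` and a small ball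
  around `p`.

A curve on the substrate becomes a closed curve `J` when the segment between its contact points is
added. The region it encloses with the whole substrate is the one enclosed by `J`
(`enclosedRegion_union_substrate`), and the curve is recovered from `J` as the closure of the part of
`J` off the substrate.
-/

open Topology Metric Set unitInterval

/-! ### Continuous logarithms -/

/-- Logarithms of a constant are locally constant: two continuous logarithms of one function differ
by a constant on a connected set. -/
theorem Complex.eqOn_const_of_exp_eq {X : Type*} [TopologicalSpace X] {s : Set X} {f : X → ℂ}
    {w : ℂ} (hs : IsPreconnected s) (hf : ContinuousOn f s) (h : ∀ x ∈ s, Complex.exp (f x) = w)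
    {x y : X} (hx : x ∈ s) (hy : y ∈ s) : f x = f y :=
  Complex.isCoveringMap_exp.constOn_of_comp hs hf
    (fun a ha b hb => Subtype.ext ((h a ha).trans (h b hb).symm)) hx hy

/-- Having a continuous logarithm is invariant under homotopies through nonvanishing functions; this
is the homotopy lifting property of the covering map `exp`. -/
theorem ContinuousMap.exists_log_of_homotopy {X : Type*} [TopologicalSpace X] (H : C(I × X, ℂ))
    (hH : ∀ p, H p ≠ 0) (f : C(X, ℂ)) (hf : ∀ x, H (0, x) = Complex.exp (f x)) :
    ∃ g : C(X, ℂ), ∀ x, Complex.exp (g x) = H (1, x) := by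
  let H' : C(I × X, {z : ℂ // z ≠ 0}) := ⟨fun p => ⟨H p, hH p⟩, by fun_prop⟩
  have h0 : ∀ x, H' (0, x) = ⟨Complex.exp (f x), Complex.exp_ne_zero _⟩ :=
    fun x => Subtype.ext (hf x)
  let G := Complex.isCoveringMap_exp.liftHomotopy H' f h0
  refine ⟨⟨fun x => G (1, x), by fun_prop⟩, fun x => ?_⟩
  exact congrArg Subtype.val
    (congrFun (Complex.isCoveringMap_exp.liftHomotopy_lifts H' f h0) (1, x))

/-- On a contractible space, with a contraction `c` to `x₀`, every nonvanishing continuous function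
has a continuous logarithm. -/
theorem ContinuousMap.exists_log_of_contraction {X : Type*} [TopologicalSpace X] (c : C(I × X, X))
    (x₀ : X) (hc0 : ∀ x, c (0, x) = x₀) (hc1 : ∀ x, c (1, x) = x) (F : C(X, ℂ))
    (hF : ∀ x, F x ≠ 0) : ∃ g : C(X, ℂ), ∀ x, Complex.exp (g x) = F x := by
  obtain ⟨g, hg⟩ := ContinuousMap.exists_log_of_homotopy (F.comp c) (fun p => hF _)
    (.const X (Complex.log (F x₀))) (fun x => by simp [hc0, Complex.exp_log (hF _)])
  exact ⟨g, fun x => by simpa [hc1] using hg x⟩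

/-- The imaginary part of such a logarithm would grow by `2π` along the circle. -/
theorem Complex.not_exists_log_sub_on_sphere {c : ℂ} {r : ℝ} (hr : 0 < r) {g : ℂ → ℂ}
    (hg : ContinuousOn g (sphere c r)) : ¬ ∀ z ∈ sphere c r, Complex.exp (g z) = z - c := by
  intro h
  have hm : ∀ θ, circleMap c r θ ∈ sphere c r := circleMap_mem_sphere c hr.le
  have hcont : Continuous fun θ : ℝ => g (circleMap c r θ) - θ * Complex.I :=
    (hg.comp_continuous (continuous_circleMap c r) hm).sub (by fun_prop)
  have key := Complex.eqOn_const_of_exp_eq (w := r) isPreconnected_univ hcont.continuousOn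
    (fun θ _ => by
      rw [Complex.exp_sub, h _ (hm θ)]
      simp [circleMap]) (mem_univ (0 : ℝ)) (mem_univ (2 * Real.pi))
  have hper : circleMap c r (2 * Real.pi) = circleMap c r 0 := by
    simpa using periodic_circleMap c r 0
  rw [hper] at key
  have : (2 * Real.pi : ℂ) * Complex.I = 0 := by
    push_cast at key
    linear_combination key
  simp [Real.pi_ne_zero] at this

/-! ### Unbounded components of the complement of a bounded set -/

/-- Components of an open set are open, so none of them meets the frontier of another one. -/
theorem frontier_connectedComponentIn_subset {X : Type*} [TopologicalSpace X]
    [LocallyConnectedSpace X] {F : Set X} (hF : IsOpen F) (x : X) :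
    frontier (connectedComponentIn F x) ⊆ Fᶜ := by
  intro y hy hyF
  rw [hF.connectedComponentIn.frontier_eq] at hy
  obtain ⟨z, hz1, hz2⟩ := mem_closure_iff.1 hy.1 _ hF.connectedComponentIn
    (mem_connectedComponentIn hyF)
  apply hy.2
  rw [connectedComponentIn_eq hz2, ← connectedComponentIn_eq hz1]
  exact mem_connectedComponentIn hyF

theorem isConnected_setOf_lt_norm {E : Type*} [NormedAddCommGroup E] [NormedSpace ℝ E]
    (h : 1 < Module.rank ℝ E) {R : ℝ} (hR : 0 ≤ R) : IsConnected {x : E | R < ‖x‖} := by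
  have h1 : IsConnected (Ioi R ×ˢ sphere (0 : E) 1) :=
    isConnected_Ioi.prod (isConnected_sphere h 0 zero_le_one)
  have h2 := h1.image (fun p : ℝ × E => p.1 • p.2) (by fun_prop)
  convert h2 using 1
  ext x
  constructor
  · intro hx
    have hx : R < ‖x‖ := hx
    have hx0 : ‖x‖ ≠ 0 := (hR.trans_lt hx).ne'
    refine ⟨(‖x‖, ‖x‖⁻¹ • x), ⟨hx, ?_⟩, ?_⟩
    · simp [norm_smul, hx0]
    · simp [smul_smul, hx0]
  · rintro ⟨⟨t, y⟩, ⟨ht, hy⟩, rfl⟩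
    have ht : R < t := ht
    have hy : ‖y‖ = 1 := by simpa using hy
    simp [norm_smul, hy, abs_of_pos (hR.trans_lt ht), ht]

theorem not_isBounded_setOf_lt_norm {E : Type*} [NormedAddCommGroup E] [NormedSpace ℝ E]
    [Nontrivial E] (R : ℝ) : ¬ Bornology.IsBounded {x : E | R < ‖x‖} := by
  intro hb
  obtain ⟨C, hC⟩ := hb.exists_norm_le
  obtain ⟨x, hx⟩ := NormedSpace.exists_lt_norm ℝ E (max R C)
  exact absurd (hC x ((le_max_left _ _).trans_lt hx)) (not_le.2 ((le_max_right _ _).trans_lt hx))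

/-- The complement of a bounded set has at most one unbounded component, since the outside of a ball
is connected. -/
theorem setOf_lt_norm_subset_connectedComponentIn {E : Type*} [NormedAddCommGroup E]
    [NormedSpace ℝ E] (h : 1 < Module.rank ℝ E) {K : Set E} {R : ℝ} (hR : 0 ≤ R)
    (hK : ∀ x ∈ K, ‖x‖ ≤ R) {p : E} (hp : ¬ Bornology.IsBounded (connectedComponentIn Kᶜ p)) :
    {x : E | R < ‖x‖} ⊆ connectedComponentIn Kᶜ p := by
  have hsub : {x : E | R < ‖x‖} ⊆ Kᶜ := fun x hx hxK => absurd (hK x hxK) (not_le.2 hx)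
  obtain ⟨q, hq1, hq2⟩ : ∃ q ∈ connectedComponentIn Kᶜ p, R < ‖q‖ := by
    by_contra! hcon
    exact hp (isBounded_iff_forall_norm_le.2 ⟨R, hcon⟩)
  rw [connectedComponentIn_eq hq1]
  exact (isConnected_setOf_lt_norm h hR).isPreconnected.subset_connectedComponentIn hq2 hsub

theorem isPreconnected_compl_of_forall_not_isBounded {E : Type*} [NormedAddCommGroup E]
    [NormedSpace ℝ E] (h : 1 < Module.rank ℝ E) {K : Set E} (hK : Bornology.IsBounded K)
    (hunb : ∀ p ∈ Kᶜ, ¬ Bornology.IsBounded (connectedComponentIn Kᶜ p)) :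
    IsPreconnected Kᶜ := by
  obtain ⟨R, hR0, hR⟩ := hK.exists_pos_norm_le
  obtain ⟨w, hw⟩ := (isConnected_setOf_lt_norm h hR0.le).nonempty
  refine isPreconnected_of_forall w fun p hp => ⟨connectedComponentIn Kᶜ p,
    connectedComponentIn_subset _ _, ?_, mem_connectedComponentIn hp,
    isPreconnected_connectedComponentIn⟩
  exact setOf_lt_norm_subset_connectedComponentIn h hR0.le hR (hunb p hp) hw

/-! ### Arcs and closed curves in the complex plane -/

theorem Complex.one_lt_rank_real : 1 < Module.rank ℝ ℂ := by simp

/-- An arc does not separate the plane. -/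
theorem Complex.isPreconnected_compl_range_arc (γ : C(I, ℂ)) (hγ : Function.Injective γ) :
    IsPreconnected (range γ)ᶜ := by
  have hK : IsCompact (range γ) := isCompact_range γ.continuous
  have ho : IsOpen (range γ)ᶜ := hK.isClosed.isOpen_compl
  refine isPreconnected_compl_of_forall_not_isBounded Complex.one_lt_rank_real hK.isBounded ?_
  intro a ha hb
  set U := connectedComponentIn (range γ)ᶜ a with hU
  have haU : a ∈ U := mem_connectedComponentIn ha
  have hfr : ∀ x ∈ frontier U, x ∈ range γ := fun x hx => by
    simpa using frontier_connectedComponentIn_subset ho a hx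
  have hne : ∀ t, γ t - a ≠ 0 := fun t ht => ha ⟨t, sub_eq_zero.1 ht⟩
  obtain ⟨f, hf⟩ := ContinuousMap.exists_log_of_contraction
    ⟨fun p : I × I => p.1 * p.2, by fun_prop⟩ 0 (by simp) (by simp)
    ⟨fun t => γ t - a, by fun_prop⟩ hne
  obtain ⟨G, hG⟩ := f.exists_extension' (γ.continuous.isClosedEmbedding hγ)
  have hGγ : ∀ t, G (γ t) = f t := fun t => congrFun hG t
  classical
  let F : C(ℂ, ℂ) := ⟨U.piecewise (fun z => Complex.exp (G z)) (fun z => z - a), by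
    refine Continuous.piecewise ?_ (by fun_prop) (by fun_prop)
    -- The two pieces agree on the frontier of `U`, which lies on the arc.
    intro z hz
    obtain ⟨t, rfl⟩ := hfr z hz
    rw [hGγ]
    exact hf t⟩
  have hF0 : ∀ z, F z ≠ 0 := by
    intro z
    by_cases hz : z ∈ U
    · simp [F, hz, Complex.exp_ne_zero]
    · have : z ≠ a := fun h => hz (h ▸ haU)
      simpa [F, hz, sub_eq_zero] using this
  obtain ⟨L, hL⟩ := ContinuousMap.exists_log_of_contraction
    ⟨fun p : I × ℂ => ((p.1 : ℝ) : ℂ) * p.2, by fun_prop⟩ 0 (by simp) (by simp) F hF0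
  obtain ⟨r, hr, hUr⟩ := hb.subset_ball_lt 0 a
  refine Complex.not_exists_log_sub_on_sphere (c := a) hr L.continuous.continuousOn fun z hz => ?_
  have hzU : z ∉ U := fun h => (mem_ball.1 (hUr h)).ne (mem_sphere.1 hz)
  rw [hL]
  simp [F, hzU]

/-- The homotopy is `(z - γ (1 - t)) / (z - γ 1)`, from the constant `1` to the quotient in question.
The path `γ` need not be simple. -/
theorem Complex.exists_log_div_on_compl_range (γ : C(I, ℂ)) :
    ∃ g : ℂ → ℂ, ContinuousOn g (range γ)ᶜ ∧
      ∀ z ∈ (range γ)ᶜ, Complex.exp (g z) = (z - γ 0) / (z - γ 1) := by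
  have hne : ∀ (t : I) (z : ((range γ)ᶜ : Set ℂ)), (z : ℂ) - γ t ≠ 0 := fun t z h =>
    z.2 ⟨t, (sub_eq_zero.1 h).symm⟩
  obtain ⟨g, hg⟩ := ContinuousMap.exists_log_of_homotopy
    (X := ((range γ)ᶜ : Set ℂ))
    ⟨fun p => ((p.2 : ℂ) - γ (σ p.1)) / ((p.2 : ℂ) - γ 1),
      Continuous.div (by fun_prop) (by fun_prop) fun p => hne _ _⟩
    (fun p => div_ne_zero (hne _ _) (hne _ _)) (.const _ 0)
    (fun z => by simp [div_self (hne 1 z)])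
  classical
  refine ⟨fun z => if h : z ∈ (range γ)ᶜ then g ⟨z, h⟩ else 0, ?_, fun z hz => ?_⟩
  · rw [continuousOn_iff_continuous_domRestrict]
    convert g.continuous using 1
    ext z
    simp only [domRestrict_apply, dif_pos z.2]
  · simp only [dif_pos hz, hg]
    simp

/-- Near `p` the factor `z - q` has a logarithm, so a logarithm of the quotient would give one of
`z - p` on a circle around `p`. -/
theorem Complex.not_exists_log_div {p q : ℂ} (hpq : p ≠ q) {g : ℂ → ℂ}
    (hg : ContinuousOn g {p, q}ᶜ) :
    ¬ ∀ z ∈ ({p, q}ᶜ : Set ℂ), Complex.exp (g z) = (z - p) / (z - q) := by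
  intro h
  have hd : 0 < ‖p - q‖ := norm_pos_iff.2 (sub_ne_zero.2 hpq)
  have hd0 : p - q ≠ 0 := sub_ne_zero.2 hpq
  have hsmall : ∀ z ∈ sphere p (‖p - q‖ / 2), ‖(z - p) / (p - q)‖ < 1 := by
    intro z hz
    rw [norm_div, mem_sphere_iff_norm.1 hz, div_div, div_lt_one (by positivity)]
    linarith
  have hslit : ∀ z ∈ sphere p (‖p - q‖ / 2), 1 + (z - p) / (p - q) ∈ Complex.slitPlane :=
    fun z hz => Complex.mem_slitPlane_of_norm_lt_one (hsmall z hz)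
  have hzq : ∀ z, z - q = (p - q) * (1 + (z - p) / (p - q)) := fun z => by field_simp; ring
  have hsub : sphere p (‖p - q‖ / 2) ⊆ ({p, q}ᶜ : Set ℂ) := by
    rintro z hz (rfl | rfl)
    · have := mem_sphere.1 hz
      rw [dist_self] at this
      linarith
    · have := mem_sphere_iff_norm.1 hz
      rw [norm_sub_rev] at this
      linarith
  refine Complex.not_exists_log_sub_on_sphere (c := p) (half_pos hd)
    (g := fun z => g z + (Complex.log (p - q) + Complex.log (1 + (z - p) / (p - q)))) ?_ ?_
  · refine (hg.mono hsub).add (continuousOn_const.add (ContinuousOn.clog ?_ hslit))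
    fun_prop
  · intro z hz
    have h1 : z - q ≠ 0 := fun h0 => hsub hz (by simp [sub_eq_zero.1 h0])
    rw [Complex.exp_add, Complex.exp_add, h z (hsub hz), Complex.exp_log hd0,
      Complex.exp_log (Complex.slitPlane_ne_zero (hslit z hz)), ← hzq]
    field_simp

/-- Two paths with common, distinct end points which do not meet elsewhere separate the plane. -/
theorem Complex.not_isPreconnected_compl_union_arcs {γ₁ γ₂ : C(I, ℂ)} (h0 : γ₁ 0 = γ₂ 0)
    (h1 : γ₁ 1 = γ₂ 1) (hne : γ₁ 0 ≠ γ₁ 1) (hinter : range γ₁ ∩ range γ₂ ⊆ {γ₁ 0, γ₁ 1}) :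
    ¬ IsPreconnected (range γ₁ ∪ range γ₂)ᶜ := by
  intro hconn
  obtain ⟨g₁, hc₁, hg₁⟩ := Complex.exists_log_div_on_compl_range γ₁
  obtain ⟨g₂, hc₂, hg₂⟩ := Complex.exists_log_div_on_compl_range γ₂
  rw [← h0, ← h1] at hg₂
  set p := γ₁ 0
  set q := γ₁ 1
  have ho₁ : IsOpen (range γ₁)ᶜ := (isCompact_range γ₁.continuous).isClosed.isOpen_compl
  have ho₂ : IsOpen (range γ₂)ᶜ := (isCompact_range γ₂.continuous).isClosed.isOpen_compl
  rw [compl_union] at hconn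
  have hdiv : ∀ z ∈ (range γ₁)ᶜ, (z - p) / (z - q) ≠ 0 := fun z hz => by
    rw [← hg₁ z hz]; exact Complex.exp_ne_zero _
  have hexp : ∀ z ∈ (range γ₁)ᶜ ∩ (range γ₂)ᶜ, Complex.exp (g₁ z - g₂ z) = 1 := fun z hz => by
    rw [Complex.exp_sub, hg₁ z hz.1, hg₂ z hz.2, div_self (hdiv z hz.1)]
  obtain ⟨k, hk1, hk⟩ : ∃ k : ℂ, Complex.exp k = 1 ∧
      ∀ z ∈ (range γ₁)ᶜ ∩ (range γ₂)ᶜ, g₁ z - g₂ z = k := by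
    rcases ((range γ₁)ᶜ ∩ (range γ₂)ᶜ).eq_empty_or_nonempty with he | ⟨w, hw⟩
    · exact ⟨0, Complex.exp_zero, fun z hz => by simp [he] at hz⟩
    · exact ⟨g₁ w - g₂ w, hexp w hw, fun z hz => Complex.eqOn_const_of_exp_eq hconn
        ((hc₁.mono inter_subset_left).sub (hc₂.mono inter_subset_right)) hexp hz hw⟩
  classical
  -- The glued logarithm on the complement of `{p, q}`.
  let g : ℂ → ℂ := fun z => if z ∈ (range γ₁)ᶜ then g₁ z else g₂ z + k
  have hgX : ∀ z ∈ (range γ₁)ᶜ, g z = g₁ z := fun z hz => if_pos hz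
  have hgY : ∀ z ∈ (range γ₂)ᶜ, g z = g₂ z + k := fun z hz => by
    by_cases hz1 : z ∈ (range γ₁)ᶜ
    · rw [hgX z hz1, ← hk z ⟨hz1, hz⟩]; ring
    · exact if_neg hz1
  have hcover : ∀ z ∈ ({p, q}ᶜ : Set ℂ), z ∈ (range γ₁)ᶜ ∨ z ∈ (range γ₂)ᶜ := by
    intro z hz
    by_contra! hcon
    exact hz (hinter ⟨not_not.1 hcon.1, not_not.1 hcon.2⟩)
  refine Complex.not_exists_log_div hne (g := g) (fun z hz => ?_) (fun z hz => ?_)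
  · refine ContinuousAt.continuousWithinAt ?_
    rcases hcover z hz with h | h
    · exact (hc₁.continuousAt (ho₁.mem_nhds h)).congr
        (Filter.eventually_of_mem (ho₁.mem_nhds h) fun y hy => (hgX y hy).symm)
    · exact ((hc₂.continuousAt (ho₂.mem_nhds h)).add continuousAt_const).congr
        (Filter.eventually_of_mem (ho₂.mem_nhds h) fun y hy => (hgY y hy).symm)
  · rcases hcover z hz with h | h
    · rw [hgX z h, hg₁ z h]
    · rw [hgY z h, Complex.exp_add, hk1, mul_one, hg₂ z h]

/-! ### Arcs and closed curves in the plane -/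

theorem ContinuousOn.exists_reparam_unitInterval {X : Type*} [TopologicalSpace X] {γ : ℝ → X}
    {a b : ℝ} (hab : a < b) (hγ : ContinuousOn γ (Icc a b)) :
    ∃ δ : C(I, X), δ 0 = γ a ∧ δ 1 = γ b ∧ range δ = γ '' Icc a b ∧
      (InjOn γ (Icc a b) → Function.Injective δ) := by
  let φ := (iccHomeoI a b hab).symm
  refine ⟨⟨fun t => γ (φ t), hγ.comp_continuous (by fun_prop) fun t => (φ t).2⟩, ?_, ?_, ?_, ?_⟩
  · simp [φ]
  · simp [φ]
  · ext x
    constructor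
    · rintro ⟨t, rfl⟩
      exact ⟨φ t, (φ t).2, rfl⟩
    · rintro ⟨t, ht, rfl⟩
      exact ⟨φ.symm ⟨t, ht⟩, by simp⟩
  · intro hinj s t hst
    exact φ.injective (Subtype.ext (hinj (φ s).2 (φ t).2 hst))

/-- The standard identification of the plane with the complex numbers. -/
noncomputable def planeHomeomorphComplex : Plane ≃ₜ ℂ :=
  Complex.orthonormalBasisOneI.repr.symm.toHomeomorph

theorem Plane.one_lt_rank_real : 1 < Module.rank ℝ Plane :=
  Module.one_lt_rank_of_one_lt_finrank (by simp)

theorem Plane.isPreconnected_compl_arc {γ : ℝ → Plane} {a b : ℝ} (hab : a < b)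
    (hγ : ContinuousOn γ (Icc a b)) (hinj : InjOn γ (Icc a b)) :
    IsPreconnected (γ '' Icc a b)ᶜ := by
  obtain ⟨δ, -, -, hr, hi⟩ := hγ.exists_reparam_unitInterval hab
  have h := Complex.isPreconnected_compl_range_arc
    ((planeHomeomorphComplex : C(Plane, ℂ)).comp δ)
    (planeHomeomorphComplex.injective.comp (hi hinj))
  rw [← planeHomeomorphComplex.isPreconnected_image, ← hr,
    image_compl_eq planeHomeomorphComplex.bijective, ← range_comp]
  exact h

theorem IsClosedCurve.isCompact {Γ : Set Plane} (hΓ : IsClosedCurve Γ) : IsCompact Γ := by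
  obtain ⟨γ, hc, -, -, rfl⟩ := hΓ
  exact isCompact_Icc.image_of_continuousOn hc

theorem IsClosedCurve.not_isPreconnected_compl {Γ : Set Plane} (hΓ : IsClosedCurve Γ) :
    ¬ IsPreconnected Γᶜ := by
  obtain ⟨γ, hc, hinj, h01, rfl⟩ := hΓ
  have hI : Icc (0 : ℝ) 1 = Icc 0 (1 / 2) ∪ Icc (1 / 2) 1 :=
    (Icc_union_Icc_eq_Icc (by norm_num) (by norm_num)).symm
  obtain ⟨δ₁, h10, h11, hr₁, -⟩ := ContinuousOn.exists_reparam_unitInterval (a := 0) (b := 1 / 2)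
    (by norm_num) (hc.mono (hI ▸ subset_union_left))
  obtain ⟨δ₂, h20, h21, hr₂, -⟩ := ContinuousOn.exists_reparam_unitInterval (a := 1 / 2) (b := 1)
    (by norm_num) (hc.mono (hI ▸ subset_union_right))
  -- The second half is run through backwards, so that both halves go from `γ 0` to `γ (1 / 2)`.
  let e : C(Plane, ℂ) := planeHomeomorphComplex
  have he : Function.Injective e := planeHomeomorphComplex.injective
  have hrσ : range (e.comp (δ₂.comp ⟨σ, by fun_prop⟩)) = e '' range δ₂ := by
    rw [← range_comp]
    exact (unitInterval.symmHomeomorph.surjective).range_comp (e ∘ δ₂)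
  have hr : range (e.comp δ₁) = e '' range δ₁ := range_comp e δ₁
  have h := Complex.not_isPreconnected_compl_union_arcs (γ₁ := e.comp δ₁)
    (γ₂ := e.comp (δ₂.comp ⟨σ, by fun_prop⟩)) (by simp [h10, h21, h01]) (by simp [h11, h20])
    (by
      simp only [ContinuousMap.comp_apply, h10, h11]
      intro heq
      have := hinj (by simp) (by norm_num) (he heq)
      norm_num at this)
    (by
      rw [hrσ, hr, ← image_inter he]
      rintro _ ⟨x, ⟨hx1, hx2⟩, rfl⟩
      rw [hr₁] at hx1
      rw [hr₂] at hx2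
      obtain ⟨s, hs, rfl⟩ := hx1
      obtain ⟨t, ht, hts⟩ := hx2
      simp only [ContinuousMap.comp_apply, h10, h11]
      rcases ht.2.eq_or_lt with rfl | ht1
      · left
        rw [← hts, h01]
      · right
        have := hinj ⟨by linarith [ht.1], ht1⟩ ⟨hs.1, by linarith [hs.2]⟩ hts
        have hs2 : s = 1 / 2 := le_antisymm hs.2 (this ▸ ht.1)
        rw [hs2]; rfl)
  rw [hrσ, hr, ← image_union, hr₁, hr₂, ← image_union, ← hI] at h
  rwa [← planeHomeomorphComplex.isPreconnected_image,
    image_compl_eq planeHomeomorphComplex.bijective]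

/-- A closed curve has a parametrization with any prescribed base point. It is the restriction of a
periodic map, hence continuous on all of `ℝ`. -/
theorem IsClosedCurve.exists_parametrization_at {Γ : Set Plane} (hΓ : IsClosedCurve Γ) {p : Plane}
    (hp : p ∈ Γ) : ∃ γ : ℝ → Plane, Continuous γ ∧ InjOn γ (Ico 0 1) ∧ γ 0 = p ∧ γ 1 = p ∧
      γ '' Icc 0 1 = Γ := by
  obtain ⟨γ, hc, hinj, h01, rfl⟩ := hΓ
  obtain ⟨t₀, ht₀, rfl⟩ := hp
  have hfr : γ (Int.fract t₀) = γ t₀ := by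
    rcases ht₀.2.eq_or_lt with rfl | h
    · simp [h01]
    · rw [Int.fract_eq_self.2 ⟨ht₀.1, h⟩]
  have hIco : ∀ x : ℝ, Int.fract x ∈ Ico (0 : ℝ) 1 := fun x =>
    ⟨Int.fract_nonneg x, Int.fract_lt_one x⟩
  refine ⟨fun t => γ (Int.fract (t₀ + t)),
    (ContinuousOn.comp_fract'' hc h01).comp (continuous_const.add continuous_id), ?_, ?_, ?_, ?_⟩
  · intro s hs t ht hst
    obtain ⟨k, hk⟩ := Int.fract_eq_fract.1 (hinj (hIco _) (hIco _) hst)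
    have h1 : (k : ℝ) < 1 := by linarith [hs.2, ht.1]
    have h2 : (-1 : ℝ) < k := by linarith [hs.1, ht.2]
    have : k = 0 := by
      have h1' : k < 1 := by exact_mod_cast h1
      have h2' : -1 < k := by exact_mod_cast h2
      omega
    subst this
    push_cast at hk
    linarith
  · simpa using hfr
  · simpa using hfr
  · ext x
    constructor
    · rintro ⟨t, -, rfl⟩
      exact ⟨_, Ico_subset_Icc_self (hIco _), rfl⟩
    · rintro ⟨t, ht, rfl⟩
      have ht' : γ (Int.fract t) = γ t := by
        rcases ht.2.eq_or_lt with rfl | h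
        · simp [h01]
        · rw [Int.fract_eq_self.2 ⟨ht.1, h⟩]
      refine ⟨Int.fract (t - t₀), Ico_subset_Icc_self (hIco _), ?_⟩
      rw [← ht']
      have : t₀ + Int.fract (t - t₀) = t - (⌊t - t₀⌋ : ℤ) := by
        rw [Int.fract]; ring
      simp only [this, Int.fract_sub_intCast]

/-- Removing a small open arc around `p` leaves an arc `A`, whose complement is connected. -/
theorem IsClosedCurve.exists_isPreconnected_compl_of_sdiff_subset_ball {Γ : Set Plane}
    (hΓ : IsClosedCurve Γ) {p : Plane} (hp : p ∈ Γ) {ε : ℝ} (hε : 0 < ε) :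
    ∃ A ⊆ Γ, Γ \ A ⊆ ball p ε ∧ IsPreconnected Aᶜ := by
  obtain ⟨γ, hc, hinj, h0, h1, rfl⟩ := hΓ.exists_parametrization_at hp
  have hn0 : ∀ᶠ t in 𝓝 (0 : ℝ), γ t ∈ ball p ε :=
    hc.continuousAt (h0 ▸ ball_mem_nhds _ hε)
  have hn1 : ∀ᶠ t in 𝓝 (1 : ℝ), γ t ∈ ball p ε :=
    hc.continuousAt (h1 ▸ ball_mem_nhds _ hε)
  obtain ⟨d₀, hd₀, hb₀⟩ := Metric.eventually_nhds_iff.1 hn0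
  obtain ⟨d₁, hd₁, hb₁⟩ := Metric.eventually_nhds_iff.1 hn1
  obtain ⟨d, hd, hdlt⟩ := exists_between (lt_min (lt_min hd₀ hd₁) (by norm_num : (0 : ℝ) < 1 / 2))
  obtain ⟨⟨hdd₀, hdd₁⟩, hd2⟩ : (d < d₀ ∧ d < d₁) ∧ d < 1 / 2 := by simpa using hdlt
  have hsub : Icc d (1 - d) ⊆ Ico 0 1 := fun t ht => ⟨hd.le.trans ht.1, by linarith [ht.2]⟩
  refine ⟨γ '' Icc d (1 - d), image_mono (Icc_subset_Icc hd.le (by linarith)), ?_,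
    Plane.isPreconnected_compl_arc (by linarith) hc.continuousOn
      (hinj.mono hsub)⟩
  rintro _ ⟨⟨t, ht, rfl⟩, hnot⟩
  by_cases htd : t < d
  · exact hb₀ (by rw [Real.dist_eq, abs_lt]; constructor <;> linarith [ht.1])
  · by_cases htd' : 1 - d < t
    · exact hb₁ (by rw [Real.dist_eq, abs_lt]; constructor <;> linarith [ht.2])
    · exact (hnot (mem_image_of_mem γ (mem_Icc.2 ⟨not_lt.1 htd, not_lt.1 htd'⟩))).elim

/-- If a ball around `p` missed `U`, then `U` and the union of `V` with this ball would disconnect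
`Aᶜ`. -/
theorem mem_closure_of_isPreconnected_compl {X : Type*} [PseudoMetricSpace X] {J U V : Set X}
    (hU : IsOpen U) (hV : IsOpen V) (hUV : Disjoint U V) (hunion : U ∪ V = Jᶜ)
    (hUne : U.Nonempty) (hVne : V.Nonempty) {p : X}
    (h : ∀ ε > 0, ∃ A ⊆ J, J \ A ⊆ ball p ε ∧ IsPreconnected Aᶜ) : p ∈ closure U := by
  by_contra hp
  obtain ⟨ε, hε, hball⟩ := Metric.isOpen_iff.1 isClosed_closure.isOpen_compl p hp
  obtain ⟨A, hAJ, hA, hconn⟩ := h ε hε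
  have hJA : Jᶜ ⊆ Aᶜ := compl_subset_compl.2 hAJ
  obtain ⟨x, -, hxU, hx⟩ := hconn U (V ∪ ball p ε) hU (hV.union isOpen_ball)
    (fun x hx => by
      by_cases hxJ : x ∈ J
      · exact Or.inr (Or.inr (hA ⟨hxJ, hx⟩))
      · have : x ∈ U ∪ V := hunion ▸ hxJ
        exact this.imp_right Or.inl)
    (hUne.mono fun x hx => ⟨hJA (hunion ▸ Or.inl hx), hx⟩)
    (hVne.mono fun x hx => ⟨hJA (hunion ▸ Or.inr hx), Or.inl hx⟩)
  rcases hx with hx | hx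
  · exact hUV.notMem_of_mem_left hxU hx
  · exact hball hx (subset_closure hxU)

/-! ### The enclosed region -/

theorem isOpen_enclosedRegion {K : Set Plane} (hK : IsClosed K) : IsOpen (enclosedRegion K) := by
  refine isOpen_iff_mem_nhds.2 fun p hp => Filter.mem_of_superset
    (hK.isOpen_compl.connectedComponentIn.mem_nhds (mem_connectedComponentIn hp.1))
    fun q hq => ⟨connectedComponentIn_subset _ _ hq, ?_⟩
  rw [← connectedComponentIn_eq hq]
  exact hp.2

theorem isOpen_compl_union_enclosedRegion {K : Set Plane} (hK : IsClosed K) :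
    IsOpen (K ∪ enclosedRegion K)ᶜ := by
  refine isOpen_iff_mem_nhds.2 fun p hp => ?_
  have hpK : p ∈ Kᶜ := fun h => hp (Or.inl h)
  refine Filter.mem_of_superset
    (hK.isOpen_compl.connectedComponentIn.mem_nhds (mem_connectedComponentIn hpK)) fun q hq => ?_
  rintro (h | h)
  · exact connectedComponentIn_subset _ _ hq h
  · refine hp (Or.inr ⟨hpK, ?_⟩)
    rw [connectedComponentIn_eq hq]
    exact h.2

theorem norm_le_of_mem_enclosedRegion {K : Set Plane} {R : ℝ} (hR : 0 ≤ R)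
    (hK : ∀ x ∈ K, ‖x‖ ≤ R) {p : Plane} (hp : p ∈ enclosedRegion K) : ‖p‖ ≤ R := by
  by_contra! hlt
  refine not_isBounded_setOf_lt_norm (E := Plane) R (hp.2.subset ?_)
  have hconn := (isConnected_setOf_lt_norm Plane.one_lt_rank_real hR).isPreconnected
  exact hconn.subset_connectedComponentIn hlt fun x hx hxK => absurd (hK x hxK) (not_le.2 hx)

theorem isBounded_enclosedRegion {K : Set Plane} (hK : Bornology.IsBounded K) :
    Bornology.IsBounded (enclosedRegion K) := by
  obtain ⟨R, hR0, hR⟩ := hK.exists_pos_norm_le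
  exact isBounded_iff_forall_norm_le.2 ⟨R, fun _ hp => norm_le_of_mem_enclosedRegion hR0.le hR hp⟩

theorem nonempty_compl_union_enclosedRegion {K : Set Plane} (hK : Bornology.IsBounded K) :
    (K ∪ enclosedRegion K)ᶜ.Nonempty := by
  obtain ⟨R, hR⟩ := (hK.union (isBounded_enclosedRegion hK)).exists_norm_le
  obtain ⟨x, hx⟩ := NormedSpace.exists_lt_norm ℝ Plane R
  exact ⟨x, fun h => absurd (hR x h) (not_le.2 hx)⟩

theorem IsClosedCurve.nonempty_enclosedRegion {Γ : Set Plane} (hΓ : IsClosedCurve Γ) :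
    (enclosedRegion Γ).Nonempty := by
  by_contra hemp
  refine hΓ.not_isPreconnected_compl (isPreconnected_compl_of_forall_not_isBounded
    Plane.one_lt_rank_real hΓ.isCompact.isBounded fun p hp hb => hemp ⟨p, hp, hb⟩)

/-- Every point of a closed curve is adherent both to the enclosed region and to the exterior. -/
theorem IsClosedCurve.frontier_closure_enclosedRegion {Γ : Set Plane} (hΓ : IsClosedCurve Γ) :
    frontier (closure (enclosedRegion Γ)) = Γ := by
  set Ω := enclosedRegion Γ
  set V := (Γ ∪ Ω)ᶜ with hVdef
  have hΩ : IsOpen Ω := isOpen_enclosedRegion hΓ.isCompact.isClosed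
  have hV : IsOpen V := isOpen_compl_union_enclosedRegion hΓ.isCompact.isClosed
  have hdisj : Disjoint Ω V := disjoint_compl_right.mono_left subset_union_right
  have hunion : Ω ∪ V = Γᶜ := by
    ext x
    have : x ∈ Ω → x ∈ Γᶜ := fun h => h.1
    simp only [hVdef, mem_union, mem_compl_iff] at this ⊢
    tauto
  have hΩne := hΓ.nonempty_enclosedRegion
  have hVne : V.Nonempty := nonempty_compl_union_enclosedRegion hΓ.isCompact.isBounded
  have hcl : closure Ω = Vᶜ := by
    apply Subset.antisymm
    · exact closure_minimal hdisj.subset_compl_right hV.isClosed_compl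
    · rw [hVdef, compl_compl]
      refine union_subset (fun p hp => ?_) subset_closure
      exact mem_closure_of_isPreconnected_compl hΩ hV hdisj hunion hΩne hVne
        fun ε hε => hΓ.exists_isPreconnected_compl_of_sdiff_subset_ball hp hε
  have hclV : closure V = Ωᶜ := by
    apply Subset.antisymm
    · exact closure_minimal hdisj.subset_compl_left hΩ.isClosed_compl
    · intro p hp
      by_cases hpΓ : p ∈ Γ
      · exact mem_closure_of_isPreconnected_compl hV hΩ hdisj.symm (union_comm Ω V ▸ hunion) hVne
          hΩne fun ε hε => hΓ.exists_isPreconnected_compl_of_sdiff_subset_ball hpΓ hε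
      · exact subset_closure fun h => h.elim hpΓ hp
  rw [hcl, frontier_compl, hV.frontier_eq, hclV, sdiff_eq, ← compl_union, hunion, compl_compl]

/-! ### Open curves on the substrate -/

theorem not_isBounded_of_ray_mem {E : Type*} [NormedAddCommGroup E] [NormedSpace ℝ E] {s : Set E}
    {p v : E} (hv : v ≠ 0) (h : ∀ t : ℝ, 0 ≤ t → p + t • v ∈ s) : ¬ Bornology.IsBounded s := by
  intro hb
  obtain ⟨C, hC0, hC⟩ := hb.exists_pos_norm_le
  have hv' : 0 < ‖v‖ := norm_pos_iff.2 hv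
  have ht : (0 : ℝ) ≤ (C + ‖p‖ + 1) / ‖v‖ := by positivity
  have h1 := hC _ (h _ ht)
  have h2 : ‖((C + ‖p‖ + 1) / ‖v‖) • v‖ = C + ‖p‖ + 1 := by
    rw [norm_smul, Real.norm_of_nonneg ht, div_mul_cancel₀ _ hv'.ne']
  have h3 := norm_sub_le (p + ((C + ‖p‖ + 1) / ‖v‖) • v) p
  rw [add_sub_cancel_left, h2] at h3
  linarith

theorem not_isBounded_connectedComponentIn_of_ray {E : Type*} [NormedAddCommGroup E]
    [NormedSpace ℝ E] {F : Set E} {p v : E} (hv : v ≠ 0) (h : ∀ t : ℝ, 0 ≤ t → p + t • v ∈ F) :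
    ¬ Bornology.IsBounded (connectedComponentIn F p) := by
  have hconn : IsPreconnected ((fun t : ℝ => p + t • v) '' Ici 0) :=
    isPreconnected_Ici.image _ (by fun_prop)
  refine not_isBounded_of_ray_mem hv fun t ht => hconn.subset_connectedComponentIn
    ⟨0, by simp, by simp⟩ ?_ ⟨t, ht, rfl⟩
  rintro _ ⟨t, ht, rfl⟩
  exact h t ht

theorem Plane.eq_of_coords {z : Plane} {x y : ℝ} (h0 : z 0 = x) (h1 : z 1 = y) : z = !₂[x, y] := by
  ext i
  fin_cases i <;> simp [h0, h1]

theorem Plane.mem_segment_substrate_iff {a b : ℝ} (hab : a < b) {z : Plane} :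
    z ∈ segment ℝ (!₂[a, 0] : Plane) !₂[b, 0] ↔ z 1 = 0 ∧ a ≤ z 0 ∧ z 0 ≤ b := by
  rw [segment_eq_image_lineMap]
  constructor
  · rintro ⟨t, ⟨ht0, ht1⟩, rfl⟩
    simp [AffineMap.lineMap_apply]
    constructor <;> nlinarith
  · rintro ⟨h1, h2, h3⟩
    have hba : 0 < b - a := sub_pos.2 hab
    refine ⟨(z 0 - a) / (b - a), ⟨div_nonneg (by linarith) hba.le,
      (div_le_one hba).2 (by linarith)⟩, ?_⟩
    ext i
    fin_cases i
    · simp [AffineMap.lineMap_apply]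
      field_simp
      ring
    · simp [AffineMap.lineMap_apply, h1]

theorem IsOpenCurveOnSubstrate.isCompact {Γ : Set Plane} (hΓ : IsOpenCurveOnSubstrate Γ) :
    IsCompact Γ := by
  obtain ⟨γ, hc, -, -, -, -, -, rfl⟩ := hΓ
  exact isCompact_Icc.image_of_continuousOn hc

theorem IsOpenCurveOnSubstrate.closure_sdiff_substrate {Γ : Set Plane}
    (hΓ : IsOpenCurveOnSubstrate Γ) : closure (Γ \ substrate) = Γ := by
  have hcomp := hΓ.isCompact
  obtain ⟨γ, hc, -, -, -, -, hioo, rfl⟩ := hΓ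
  refine Subset.antisymm (closure_minimal sdiff_subset hcomp.isClosed) ?_
  have h1 : γ '' Ioo 0 1 ⊆ γ '' Icc 0 1 \ substrate := by
    rintro _ ⟨t, ht, rfl⟩
    exact ⟨⟨t, Ioo_subset_Icc_self ht, rfl⟩, hioo t ht⟩
  have h2 : closure (Ioo (0 : ℝ) 1) = Icc 0 1 := closure_Ioo (by norm_num)
  have h3 : γ '' closure (Ioo (0 : ℝ) 1) ⊆ closure (γ '' Ioo 0 1) :=
    ContinuousOn.image_closure (h2 ▸ hc)
  rw [h2] at h3
  exact h3.trans (closure_mono h1)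

/-- An open curve on the substrate has its contact points at `(a, 0)` and `(b, 0)`, lies
otherwise on one side of the substrate (the upper side for `s = 1`, the lower one for `s = -1`), and is closed up
to a closed curve by the segment between the contact points. -/
theorem IsOpenCurveOnSubstrate.exists_side_and_isClosedCurve_union_segment {Γ : Set Plane}
    (hΓ : IsOpenCurveOnSubstrate Γ) : ∃ a b s : ℝ, a < b ∧ s * s = 1 ∧
      (∀ z ∈ Γ, 0 < s * z 1 ∨ z ∈ segment ℝ (!₂[a, 0] : Plane) !₂[b, 0]) ∧
      IsClosedCurve (Γ ∪ segment ℝ !₂[a, 0] !₂[b, 0]) := by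
  obtain ⟨γ, hc, hinj, h0, h1, hlt, hioo, rfl⟩ := hΓ
  have e0 : γ 0 = !₂[γ 0 0, 0] := Plane.eq_of_coords rfl h0
  have e1 : γ 1 = !₂[γ 1 0, 0] := Plane.eq_of_coords rfl h1
  have hy : ContinuousOn (fun t => γ t 1) (Icc 0 1) := by fun_prop
  obtain ⟨s, hs, hpos⟩ : ∃ s : ℝ, s * s = 1 ∧ ∀ t ∈ Ioo (0 : ℝ) 1, 0 < s * γ t 1 := by
    obtain ⟨s, hs, hs2⟩ : ∃ s : ℝ, s * s = 1 ∧ 0 ≤ s * γ (1 / 2) 1 := by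
      rcases le_total 0 (γ (1 / 2) 1) with h | h
      · exact ⟨1, by norm_num, by simpa using h⟩
      · exact ⟨-1, by norm_num, by simpa using h⟩
    refine ⟨s, hs, fun t ht => ?_⟩
    by_contra! hneg
    obtain ⟨u, hu, hu0⟩ := isPreconnected_Ioo.intermediate_value ht
      (⟨by norm_num, by norm_num⟩ : (1 / 2 : ℝ) ∈ Ioo (0 : ℝ) 1)
      ((continuousOn_const.mul hy).mono Ioo_subset_Icc_self) ⟨hneg, hs2⟩
    have hs0 : s ≠ 0 := by rintro rfl; simp at hs
    exact hioo u hu ((mul_eq_zero.1 hu0).resolve_left hs0)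
  refine ⟨γ 0 0, γ 1 0, s, hlt, hs, ?_, ?_⟩
  · rintro _ ⟨t, ht, rfl⟩
    rcases ht.1.eq_or_lt with rfl | ht0
    · exact Or.inr (e0 ▸ left_mem_segment ℝ _ _)
    rcases ht.2.eq_or_lt with rfl | ht1
    · exact Or.inr (e1 ▸ right_mem_segment ℝ _ _)
    exact Or.inl (hpos t ⟨ht0, ht1⟩)
  rw [← e0, ← e1]
  set η : ℝ → Plane := fun t =>
    if t ≤ 1 / 2 then γ (2 * t) else AffineMap.lineMap (γ 1) (γ 0) (2 * t - 1) with hη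
  have hη1 : ∀ t ≤ 1 / 2, η t = γ (2 * t) := fun t ht => if_pos ht
  have hη2 : ∀ t, 1 / 2 ≤ t → η t = AffineMap.lineMap (γ 1) (γ 0) (2 * t - 1) := by
    intro t ht
    rcases ht.eq_or_lt with rfl | ht
    · rw [hη1 _ le_rfl]; norm_num
    · exact if_neg (not_le.2 ht)
  have hI : Icc (0 : ℝ) 1 = Icc 0 (1 / 2) ∪ Icc (1 / 2) 1 :=
    (Icc_union_Icc_eq_Icc (by norm_num) (by norm_num)).symm
  have hx : ∀ t, 1 / 2 ≤ t → η t 0 = γ 1 0 + (2 * t - 1) * (γ 0 0 - γ 1 0) := by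
    intro t ht
    rw [hη2 t ht, AffineMap.lineMap_apply]
    simp
    ring
  have hy0 : ∀ t, 1 / 2 ≤ t → η t 1 = 0 := by
    intro t ht
    have h0' : γ 0 1 = 0 := h0
    have h1' : γ 1 1 = 0 := h1
    rw [hη2 t ht, AffineMap.lineMap_apply]
    simp [h0', h1']
  have hmixed : ∀ t u, 0 ≤ t → t ≤ 1 / 2 → 1 / 2 < u → u < 1 → η t ≠ η u := by
    intro t u ht0 ht hu hu1 heq
    have hyt : γ (2 * t) 1 = 0 := by rw [← hη1 t ht, heq, hy0 u hu.le]
    have hxu := hx u hu.le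
    rw [← heq, hη1 t ht] at hxu
    rcases ht0.eq_or_lt with rfl | ht0
    · rw [mul_zero] at hxu
      nlinarith
    rcases ht.eq_or_lt with rfl | ht
    · norm_num at hxu
      rcases hxu with h | h <;> linarith
    exact hioo (2 * t) ⟨by linarith, by linarith⟩ hyt
  refine ⟨η, ?_, ?_, ?_, ?_⟩
  · rw [hI]
    refine ContinuousOn.union_of_isClosed ?_ ?_ isClosed_Icc isClosed_Icc
    · refine ContinuousOn.congr (f := fun t => γ (2 * t)) ?_ fun t ht => hη1 t ht.2
      exact hc.comp (by fun_prop) fun t ht => ⟨by linarith [ht.1], by linarith [ht.2]⟩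
    · refine ContinuousOn.congr (f := fun t => AffineMap.lineMap (γ 1) (γ 0) (2 * t - 1)) ?_
        fun t ht => hη2 t ht.1
      exact (AffineMap.lineMap_continuous.comp (by fun_prop)).continuousOn
  · intro t ht u hu heq
    rcases le_or_gt t (1 / 2) with ht2 | ht2 <;> rcases le_or_gt u (1 / 2) with hu2 | hu2
    · rw [hη1 t ht2, hη1 u hu2] at heq
      have := hinj ⟨by linarith [ht.1], by linarith⟩ ⟨by linarith [hu.1], by linarith⟩ heq
      linarith
    · exact absurd heq (hmixed t u ht.1 ht2 hu2 hu.2)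
    · exact absurd heq.symm (hmixed u t hu.1 hu2 ht2 ht.2)
    · have hxt := hx t ht2.le
      rw [heq, hx u hu2.le] at hxt
      have : (u - t) * (γ 0 0 - γ 1 0) = 0 := by linarith
      rcases mul_eq_zero.1 this with h | h <;> linarith
  · rw [hη1 0 (by norm_num), hη2 1 (by norm_num)]
    norm_num
  · rw [hI, image_union]
    congr 1
    · rw [image_congr (fun t ht => hη1 t ht.2), ← hI]
      ext z
      constructor
      · rintro ⟨t, ht, rfl⟩
        exact ⟨2 * t, ⟨by linarith [ht.1], by linarith [ht.2]⟩, rfl⟩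
      · rintro ⟨t, ht, rfl⟩
        exact ⟨t / 2, ⟨by linarith [ht.1], by linarith [ht.2]⟩, by dsimp only; congr 1; ring⟩
    · rw [image_congr (fun t ht => hη2 t ht.1), segment_symm, segment_eq_image_lineMap]
      ext z
      constructor
      · rintro ⟨t, ht, rfl⟩
        exact ⟨2 * t - 1, ⟨by linarith [ht.1], by linarith [ht.2]⟩, rfl⟩
      · rintro ⟨t, ht, rfl⟩
        exact ⟨(t + 1) / 2, ⟨by linarith [ht.1], by linarith [ht.2]⟩, by dsimp only; congr 1; ring⟩

/-- Closing up by the whole substrate encloses the same region as closing up by the segment between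
the contact points. The delicate point is that a bounded component `U` of the complement of
`Γ ∪ substrate` cannot lie in an unbounded component of the complement of the closed curve: otherwise
`U` would have a frontier point on the substrate off the segment, and would then contain a thin strip
along the whole ray of the substrate from this point outwards. -/
theorem enclosedRegion_union_substrate {Γ : Set Plane} (hΓ : IsCompact Γ) {a b s : ℝ} (hab : a < b)
    (hs : s * s = 1)
    (hside : ∀ z ∈ Γ, 0 < s * z 1 ∨ z ∈ segment ℝ (!₂[a, 0] : Plane) !₂[b, 0]) :
    enclosedRegion (Γ ∪ substrate) = enclosedRegion (Γ ∪ segment ℝ !₂[a, 0] !₂[b, 0]) := by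
  set L := segment ℝ (!₂[a, 0] : Plane) !₂[b, 0] with hL
  have hmemL : ∀ z : Plane, z ∈ L ↔ z 1 = 0 ∧ a ≤ z 0 ∧ z 0 ≤ b := fun z =>
    Plane.mem_segment_substrate_iff hab
  have hs0 : s ≠ 0 := by rintro rfl; simp at hs
  have hJK : (Γ ∪ substrate)ᶜ ⊆ (Γ ∪ L)ᶜ := compl_subset_compl.2
    (union_subset_union_right _ fun z hz => ((hmemL z).1 hz).1)
  have hLc : IsCompact L := by
    rw [hL, segment_eq_image_lineMap]
    exact isCompact_Icc.image AffineMap.lineMap_continuous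
  have hJc : IsCompact (Γ ∪ L) := hΓ.union hLc
  have hsub : IsClosed substrate :=
    isClosed_eq (by fun_prop : Continuous fun z : Plane => z 1) continuous_const
  have hKo : IsOpen (Γ ∪ substrate)ᶜ := (hΓ.isClosed.union hsub).isOpen_compl
  have hJside : ∀ z ∈ Γ ∪ L, 0 < s * z 1 ∨ z ∈ L := fun z hz =>
    hz.elim (hside z) Or.inr
  -- The vertical ray from `p`, pointing away from the side of the curve.
  have hdown : ∀ p : Plane, ∀ t : ℝ, s * (p + t • (!₂[0, -s] : Plane)) 1 = s * p 1 - t := by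
    intro p t
    simp only [PiLp.add_apply, PiLp.smul_apply, smul_eq_mul]
    simp
    linear_combination (-t) * hs
  have hv : (!₂[0, -s] : Plane) ≠ 0 := fun h =>
    hs0 (by simpa using congrArg (fun z : Plane => z 1) h)
  have hlow : ∀ p : Plane, s * p 1 < 0 →
      ¬ Bornology.IsBounded (connectedComponentIn (Γ ∪ substrate)ᶜ p) := by
    intro p hp
    refine not_isBounded_connectedComponentIn_of_ray hv fun t ht hmem => ?_
    have h1 := hdown p t
    rcases hmem with h | h
    · rcases hside _ h with h' | h'
      · linarith
      · rw [((hmemL _).1 h').1, mul_zero] at h1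
        linarith
    · rw [show (p + t • (!₂[0, -s] : Plane)) 1 = 0 from h, mul_zero] at h1
      linarith
  have hlow' : ∀ p ∈ (Γ ∪ L)ᶜ, s * p 1 ≤ 0 →
      ¬ Bornology.IsBounded (connectedComponentIn (Γ ∪ L)ᶜ p) := by
    intro p hpJ hp
    refine not_isBounded_connectedComponentIn_of_ray hv fun t ht hmem => ?_
    have h1 := hdown p t
    rcases hJside _ hmem with h' | h'
    · linarith
    · have h2 := ((hmemL _).1 h').1
      rw [h2, mul_zero] at h1
      have : t = 0 := by linarith
      subst this
      rw [zero_smul, add_zero] at hmem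
      exact hpJ hmem
  -- From a point of the substrate off the segment, one horizontal ray avoids the closed curve.
  have hray : ∀ w ∈ (Γ ∪ L)ᶜ, w 1 = 0 →
      ∃ m : ℝ, m ≠ 0 ∧ ∀ t : ℝ, 0 ≤ t → w + t • (!₂[m, 0] : Plane) ∈ (Γ ∪ L)ᶜ := by
    intro w hw hw1
    have hnotL : ¬ (a ≤ w 0 ∧ w 0 ≤ b) := fun h => hw (Or.inr ((hmemL w).2 ⟨hw1, h⟩))
    obtain ⟨m, hm, hm'⟩ : ∃ m : ℝ, m ≠ 0 ∧ ∀ t : ℝ, 0 ≤ t →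
        ¬ (a ≤ w 0 + t * m ∧ w 0 + t * m ≤ b) := by
      rcases lt_or_ge (w 0) a with h | h
      · exact ⟨-1, by norm_num, fun t ht h' => by linarith [h'.1]⟩
      · have : b < w 0 := by
          by_contra! hb
          exact hnotL ⟨h, hb⟩
        exact ⟨1, by norm_num, fun t ht h' => by linarith [h'.2]⟩
    refine ⟨m, hm, fun t ht hmem => ?_⟩
    rcases hJside _ hmem with h | h
    · simp [hw1] at h
    · exact hm' t ht (by simpa using ((hmemL _).1 h).2)
  apply Subset.antisymm
  · rintro p ⟨hpK, hpb⟩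
    refine ⟨hJK hpK, ?_⟩
    by_contra hunb
    set U := connectedComponentIn (Γ ∪ substrate)ᶜ p with hU
    set W := connectedComponentIn (Γ ∪ L)ᶜ p with hW
    have hUW : U ⊆ W := connectedComponentIn_mono p hJK
    have hpU : p ∈ U := mem_connectedComponentIn hpK
    have hUo : IsOpen U := hKo.connectedComponentIn
    obtain ⟨w, hwW, hwU⟩ : (W ∩ frontier U).Nonempty := by
      by_contra hemp
      refine hunb (hpb.subset (isPreconnected_connectedComponentIn.subset_of_closure_inter_subset
        hUo ⟨p, hUW hpU, hpU⟩ ?_))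
      rintro x ⟨hxU, hxW⟩
      by_contra hx
      exact hemp ⟨x, hxW, hUo.frontier_eq ▸ ⟨hxU, hx⟩⟩
    have hwJ : w ∈ (Γ ∪ L)ᶜ := connectedComponentIn_subset _ _ hwW
    have hw1 : w 1 = 0 := by
      have h : w ∈ Γ ∪ substrate := by
        simpa only [compl_compl] using frontier_connectedComponentIn_subset hKo p hwU
      exact h.resolve_left fun h => hwJ (Or.inl h)
    obtain ⟨m, hm, hmJ⟩ := hray w hwJ hw1
    set T : Set Plane := {z | z 1 = 0 ∧ 0 ≤ (z 0 - w 0) * m} with hT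
    have hTJ : T ⊆ (Γ ∪ L)ᶜ := by
      rintro z ⟨hz1, hz0⟩
      have hzw : z = w + ((z 0 - w 0) / m) • (!₂[m, 0] : Plane) := by
        ext i
        fin_cases i
        · simp [hm]
        · simp [hz1, hw1]
      rw [hzw]
      refine hmJ _ ?_
      rw [← mul_div_mul_right _ _ hm]
      exact div_nonneg hz0 (mul_self_nonneg m)
    have hTclosed : IsClosed T :=
      (isClosed_eq (by fun_prop : Continuous fun z : Plane => z 1) continuous_const).inter
        (isClosed_le continuous_const (by fun_prop : Continuous fun z : Plane => (z 0 - w 0) * m))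
    have hTconv : Convex ℝ T := by
      rintro x ⟨hx1, hx0⟩ y ⟨hy1, hy0⟩ α β hα hβ hαβ
      refine ⟨by simp [hx1, hy1], ?_⟩
      have h : ((α • x + β • y) 0 - w 0) * m =
          α * ((x 0 - w 0) * m) + β * ((y 0 - w 0) * m) := by
        simp only [PiLp.add_apply, PiLp.smul_apply, smul_eq_mul]
        linear_combination (w 0 * m) * hαβ
      rw [h]
      positivity
    -- The strip of width `δ` along `T`, on the side of the curve, is convex, avoids the curve and the
    -- substrate, and meets `U`; so it lies in `U`.
    obtain ⟨δ, hδ, hdisj⟩ := Disjoint.exists_thickenings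
      (disjoint_left.2 fun z hz hzT => hTJ hzT hz) hJc hTclosed
    have hwT : w ∈ T := ⟨hw1, by simp⟩
    obtain ⟨q, hqT, hqU⟩ := mem_closure_iff.1 (frontier_subset_closure hwU) _ isOpen_thickening
      (self_subset_thickening hδ T hwT)
    have hqK : q ∈ (Γ ∪ substrate)ᶜ := connectedComponentIn_subset _ _ hqU
    have hUq : U = connectedComponentIn (Γ ∪ substrate)ᶜ q := connectedComponentIn_eq hqU
    have hqH : 0 < s * q 1 := by
      rcases lt_trichotomy (s * q 1) 0 with h | h | h
      · exact absurd (hUq ▸ hpb) (hlow q h)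
      · exact absurd (Or.inr ((mul_eq_zero.1 h).resolve_left hs0)) hqK
      · exact h
    have hHconv : Convex ℝ {z : Plane | 0 < s * z 1} := by
      intro x hx y hy α β hα hβ hαβ
      have hx : 0 < s * x 1 := hx
      have hy : 0 < s * y 1 := hy
      have h : s * (α • x + β • y) 1 = α * (s * x 1) + β * (s * y 1) := by
        simp only [PiLp.add_apply, PiLp.smul_apply, smul_eq_mul]
        ring
      change 0 < s * (α • x + β • y) 1
      rw [h]
      rcases hα.eq_or_lt with rfl | hα
      · rw [zero_add] at hαβ
        simpa [hαβ] using hy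
      · positivity
    have hCK : thickening δ T ∩ {z | 0 < s * z 1} ⊆ (Γ ∪ substrate)ᶜ := by
      rintro z ⟨hzT, hzH⟩ (h | h)
      · exact hdisj.notMem_of_mem_left (self_subset_thickening hδ _ (Or.inl h)) hzT
      · have hzH : 0 < s * z 1 := hzH
        rw [show z 1 = 0 from h, mul_zero] at hzH
        exact lt_irrefl _ hzH
    have hCU : thickening δ T ∩ {z | 0 < s * z 1} ⊆ U := by
      rw [hUq]
      exact ((hTconv.thickening δ).inter hHconv).isPreconnected.subset_connectedComponentIn
        ⟨hqT, hqH⟩ hCK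
    refine not_isBounded_of_ray_mem (p := w + (!₂[0, s * (δ / 2)] : Plane)) (v := !₂[m, 0])
      (fun h => hm (by simpa using congrArg (fun z : Plane => z 0) h))
      (fun t ht => hCU ⟨?_, ?_⟩) hpb
    · refine mem_thickening_iff.2 ⟨w + t • (!₂[m, 0] : Plane), ⟨by simp [hw1], ?_⟩, ?_⟩
      · simp only [PiLp.add_apply, PiLp.smul_apply, smul_eq_mul]
        simp only [Matrix.cons_val_zero, add_sub_cancel_left, mul_assoc]
        exact mul_nonneg ht (mul_self_nonneg m)
      · have hnorm : ‖(!₂[0, s * (δ / 2)] : Plane)‖ = δ / 2 := by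
          rw [EuclideanSpace.norm_eq]
          simp only [Fin.sum_univ_two]
          rw [show ‖(!₂[0, s * (δ / 2)] : Plane) 0‖ ^ 2 + ‖(!₂[0, s * (δ / 2)] : Plane) 1‖ ^ 2 =
            (δ / 2) ^ 2 by
              simp only [Real.norm_eq_abs, sq_abs]
              simp
              linear_combination (δ ^ 2 / 4) * hs]
          exact Real.sqrt_sq (by positivity)
        rw [dist_eq_norm, add_right_comm, add_sub_cancel_left, hnorm]
        linarith
    · change 0 < s * (w + (!₂[0, s * (δ / 2)] : Plane) + t • (!₂[m, 0] : Plane)) 1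
      simp [hw1]
      nlinarith
  · rintro p ⟨hpJ, hpb⟩
    have hp : 0 < s * p 1 := by
      by_contra! h
      exact hlow' p hpJ h hpb
    refine ⟨?_, hpb.subset (connectedComponentIn_mono p hJK)⟩
    rintro (h | h)
    · exact hpJ (Or.inl h)
    · rw [show p 1 = 0 from h, mul_zero] at hp
      exact lt_irrefl _ hp

/-! ### The manifold distance -/

theorem IsOpenCurveOnSubstrate.exists_isClosedCurve {Γ : Set Plane}
    (hΓ : IsOpenCurveOnSubstrate Γ) : ∃ J, IsClosedCurve J ∧
      enclosedRegion (Γ ∪ substrate) = enclosedRegion J ∧ closure (J \ substrate) = Γ := by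
  obtain ⟨a, b, s, hab, hs, hside, hJ⟩ := hΓ.exists_side_and_isClosedCurve_union_segment
  refine ⟨_, hJ, enclosedRegion_union_substrate hΓ.isCompact hab hs hside, ?_⟩
  have hsub : segment ℝ (!₂[a, 0] : Plane) !₂[b, 0] ⊆ substrate := fun z hz =>
    ((Plane.mem_segment_substrate_iff hab).1 hz).1
  rw [union_sdiff_distrib, sdiff_eq_empty.2 hsub, union_empty, hΓ.closure_sdiff_substrate]

/-- In either setting the inner region is the region enclosed by a closed curve. -/
theorem CurveSetting.IsCurve.exists_isClosedCurve {S : CurveSetting} {Γ : Set Plane}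
    (hΓ : S.IsCurve Γ) : ∃ J, IsClosedCurve J ∧ S.innerRegion Γ = enclosedRegion J := by
  cases S with
  | closed => exact ⟨Γ, hΓ, rfl⟩
  | onSubstrate =>
    obtain ⟨J, hJ, h, -⟩ := IsOpenCurveOnSubstrate.exists_isClosedCurve hΓ
    exact ⟨J, hJ, h⟩

theorem CurveSetting.IsCurve.isOpen_innerRegion {S : CurveSetting} {Γ : Set Plane}
    (hΓ : S.IsCurve Γ) : IsOpen (S.innerRegion Γ) := by
  obtain ⟨J, hJ, h⟩ := hΓ.exists_isClosedCurve
  exact h ▸ isOpen_enclosedRegion hJ.isCompact.isClosed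

theorem CurveSetting.IsCurve.volume_innerRegion_lt_top {S : CurveSetting} {Γ : Set Plane}
    (hΓ : S.IsCurve Γ) : volume (S.innerRegion Γ) < ⊤ := by
  obtain ⟨J, hJ, h⟩ := hΓ.exists_isClosedCurve
  exact h ▸ (isBounded_enclosedRegion hJ.isCompact.isBounded).measure_lt_top

theorem CurveSetting.IsCurve.eq_of_closure_innerRegion_eq {S : CurveSetting} {Γ₁ Γ₂ : Set Plane}
    (h₁ : S.IsCurve Γ₁) (h₂ : S.IsCurve Γ₂)
    (h : closure (S.innerRegion Γ₁) = closure (S.innerRegion Γ₂)) : Γ₁ = Γ₂ := by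
  cases S with
  | closed =>
    rw [← IsClosedCurve.frontier_closure_enclosedRegion h₁,
      ← IsClosedCurve.frontier_closure_enclosedRegion h₂]
    exact congrArg frontier h
  | onSubstrate =>
    obtain ⟨J₁, hJ₁, hΩ₁, hΓ₁⟩ := IsOpenCurveOnSubstrate.exists_isClosedCurve h₁
    obtain ⟨J₂, hJ₂, hΩ₂, hΓ₂⟩ := IsOpenCurveOnSubstrate.exists_isClosedCurve h₂
    rw [← hΓ₁, ← hΓ₂, ← hJ₁.frontier_closure_enclosedRegion, ← hJ₂.frontier_closure_enclosedRegion,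
      ← hΩ₁, ← hΩ₂]
    exact congrArg (fun C => closure (frontier C \ substrate)) h

theorem IsOpen.subset_closure_of_measure_sdiff_eq_zero {X : Type*} [TopologicalSpace X]
    [MeasurableSpace X] {μ : Measure X} [μ.IsOpenPosMeasure] {U V : Set X} (hU : IsOpen U)
    (h : μ (U \ V) = 0) : U ⊆ closure V := by
  have h0 : μ (U \ closure V) = 0 := measure_mono_null (sdiff_subset_sdiff_right subset_closure) h
  exact sdiff_eq_empty.1 ((hU.sdiff isClosed_closure).eq_empty_of_measure_zero h0)

theorem proposition5p1 (S : CurveSetting) (Γ₁ Γ₂ Γ₃ : Set Plane)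
    (h₁ : S.IsCurve Γ₁) (h₂ : S.IsCurve Γ₂) (h₃ : S.IsCurve Γ₃) :
    -- the inner regions have a finite area, and the two expressions for the distance agree
    (MeasurableSet (S.innerRegion Γ₁) ∧ volume (S.innerRegion Γ₁) < ⊤ ∧
      manifoldDistance S Γ₁ Γ₂ =
        volume.real (S.innerRegion Γ₁) + volume.real (S.innerRegion Γ₂)
          - 2 * volume.real (S.innerRegion Γ₁ ∩ S.innerRegion Γ₂)) ∧
    -- symmetry
    manifoldDistance S Γ₁ Γ₂ = manifoldDistance S Γ₂ Γ₁ ∧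
    -- positivity
    0 ≤ manifoldDistance S Γ₁ Γ₂ ∧
    (manifoldDistance S Γ₁ Γ₂ = 0 ↔ Γ₁ = Γ₂) ∧
    -- triangle inequality
    manifoldDistance S Γ₁ Γ₂ ≤ manifoldDistance S Γ₁ Γ₃ + manifoldDistance S Γ₂ Γ₃ := by
  have hm₁ := h₁.isOpen_innerRegion.measurableSet
  have hm₂ := h₂.isOpen_innerRegion.measurableSet
  have hf₁ := h₁.volume_innerRegion_lt_top.ne
  have hf₂ := h₂.volume_innerRegion_lt_top.ne
  have hf₃ := h₃.volume_innerRegion_lt_top.ne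
  have hsymm : ∀ Γ Γ' : Set Plane, manifoldDistance S Γ Γ' = manifoldDistance S Γ' Γ :=
    fun Γ Γ' => congrArg volume.real (union_comm _ _)
  refine ⟨⟨hm₁, h₁.volume_innerRegion_lt_top, ?_⟩, hsymm _ _, measureReal_nonneg, ⟨fun h => ?_, ?_⟩,
    ?_⟩
  · have hsd : manifoldDistance S Γ₁ Γ₂ = volume.real (S.innerRegion Γ₁ \ S.innerRegion Γ₂) +
        volume.real (S.innerRegion Γ₂ \ S.innerRegion Γ₁) := measureReal_symmDiff_eq hm₁ hm₂ hf₁ hf₂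
    have e₁ := measureReal_inter_add_sdiff (μ := volume) (s := S.innerRegion Γ₁) hm₂ hf₁
    have e₂ := measureReal_inter_add_sdiff (μ := volume) (s := S.innerRegion Γ₂) hm₁ hf₂
    rw [inter_comm] at e₂
    linarith
  · have h0 : volume (S.innerRegion Γ₁ \ S.innerRegion Γ₂ ∪
        S.innerRegion Γ₂ \ S.innerRegion Γ₁) = 0 :=
      (measureReal_eq_zero_iff (measure_union_ne_top
        (measure_ne_top_of_subset sdiff_subset hf₁)
        (measure_ne_top_of_subset sdiff_subset hf₂))).1 h
    rw [measure_union_null_iff] at h0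
    exact h₁.eq_of_closure_innerRegion_eq h₂ (Subset.antisymm
      (closure_minimal (h₁.isOpen_innerRegion.subset_closure_of_measure_sdiff_eq_zero h0.1)
        isClosed_closure)
      (closure_minimal (h₂.isOpen_innerRegion.subset_closure_of_measure_sdiff_eq_zero h0.2)
        isClosed_closure))
  · rintro rfl
    simp [manifoldDistance]
  · rw [hsymm Γ₂ Γ₃]
    exact measureReal_symmDiff_le (S.innerRegion Γ₂) hf₁ hf₃
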